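/- **Conventions.** Let $\mathscr A$ be an abelian category. A *subcategory* of $\mathscr A$ means a full additive subcategory closed under isomorphism. Let $\mathscr X$ be a subcategory. - A *left $\mathscr X$-resolution* of an object $M$ is a complex $\cdots\to X_1\to X_0\to M\to 0$ with all $X_i\in\mathscr X$ that becomes acyclic under $\mathrm{Hom}_{\mathscr A}(X,-)$ for every $X\in\mathscr X$; the complex $\cdots\to X_1\to X_0\to 0$ is then the *deleted* resolution. For a subcategory $\mathscr Y$, a *right $\mathscr Y$-coresolution* of $N$ is a complex $0\to N\to Y^0\to Y^1\to\cdots$ with all $Y^i\in\mathscr Y$ that becomes acyclic under $\mathrm{Hom}_{\mathscr A}(-,Y)$ for every $Y\in\mathscr Y$. - $\mathscr X\text{-}\dim M\in\mathbb N\cup\{\infty\}$ is the infimum of the $n\ge 0$ for which there is an exact sequence $0\to X_n\to\cdots\to X_0\to M\to 0$ that is a left $\mathscr X$-resolution of $M$. - A *right $\mathscr X$-approximation* of $M$ is a morphism $f\colon X\to M$ with $X\in\mathscr X$ such that every morphism from an object of $\mathscr X$ to $M$ factors through $f$; $\mathscr X$ is *contravariantly finite* if every object has one. Left approximations and *covariantly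 finite* subcategories are defined dually. - A pair $(\mathscr X,\mathscr Y)$ of subcategories is *balanced* if $\mathscr X$ is contravariantly finite, $\mathscr Y$ is covariantly finite, every object has a left $\mathscr X$-resolution that is acyclic under $\mathrm{Hom}_{\mathscr A}(-,Y)$ for all $Y\in\mathscr Y$, and every object has a right $\mathscr Y$-coresolution that is acyclic under $\mathrm{Hom}_{\mathscr A}(X,-)$ for all $X\in\mathscr X$. It is *admissible* if moreover every right $\mathscr X$-approximation is an epimorphism. - For a balanced pair $(\mathscr X,\mathscr Y)$, $\mathrm{Ext}^i_{\mathscr X}(M,N)$ is the $i$-th cohomology of $\mathrm{Hom}_{\mathscr A}(X_\bullet,N)$, where $X_\bullet$ is the deleted complex of a left $\mathscr X$-resolution of $M$ (this does not depend on the resolution, up to isomorphism). - For an admissible balanced pair $(\mathscr X,\mathscr Y)$ and $n\ge 0$, an object $T$ is *partial $n$-$\mathscr X$-tilting* if $\mathscr X\text{-}\dim T\le n$ and $\mathrm{Ext}^i_{\mathscr X}(T,T^{(I)})=0$ for all $i>0$ and all sets $I$ for which the coproduct $T^{(I)}$ of $I$ copies of $T$ exists in $\mathscr A$. **Setting.**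 Let $\mathscr A',\mathscr A,\mathscr A''$ be abelian categories forming a recollement, i.e. let additive functors $i^*,i^!\colon\mathscr A\to\mathscr A'$, $i_*\colon\mathscr A'\to\mathscr A$, $j_!,j_*\colon\mathscr A''\to\mathscr A$, $j^*\colon\mathscr A\to\mathscr A''$ be given such that $(i^*,i_*,i^!)$ and $(j_!,j^*,j_*)$ are adjoint triples, $i_*,j_!,j_*$ are fully faithful, and the essential image of $i_*$ is the kernel of $j^*$. Let $(\mathscr X',\mathscr Y')$ and $(\mathscr X'',\mathscr Y'')$ be admissible balanced pairs in $\mathscr A'$ and $\mathscr A''$, respectively, and set $$\mathscr X=\{X\in\mathscr A\mid i^*X\in\mathscr X',\ j^*X\in\mathscr X''\},\qquad \mathscr Y=\{Y\in\mathscr A\mid i^!Y\in\mathscr Y',\ j^*Y\in\mathscr Y''\}.$$ **Proposition 4.2.** Suppose that $(\mathscr X,\mathscr Y)$ is an admissible balanced pair in $\mathscr A$ and that $i^*$ is exact. Let $n\ge 0$. If $T'\in\mathscr A'$ is partial $n$-$\mathscr X'$-tilting and $T''\in\mathscr A''$ is partial $n$-$\mathscr X''$-tilting, then $i_*T'\oplus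 j_!T''$ is partial $n$-$\mathscr X$-tilting in $\mathscr A$. -/

import Mathlib

open CategoryTheory CategoryTheory.Limits Opposite

universe w v v₁ v₂ v₃ u u₁ u₂ u₃

namespace RelTilt

section Abelian

variable {C : Type u} [Category.{v} C] [Abelian C]

/-- `Hom(D, K)` is acyclic for every `D` in `X`: the complex `K` is (right) `X`-acyclic. -/
def HomFromAcyclic (X : ObjectProperty C) {ι : Type*} {c : ComplexShape ι}
    (K : HomologicalComplex C c) : Prop :=
  ∀ D : C, X D →
    (((preadditiveCoyoneda.obj (op D)).mapHomologicalComplex c).obj K).Acyclic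

/-- `Hom(K, D)` is acyclic for every `D` in `Y`: the complex `K` is (left) `Y`-acyclic. -/
def HomToAcyclic (Y : ObjectProperty C) {ι : Type*} {c : ComplexShape ι}
    (K : HomologicalComplex C c) : Prop :=
  ∀ D : C, Y D →
    (((preadditiveYoneda.obj D).mapHomologicalComplex c.symm).obj K.op).Acyclic

/-- A left `X`-resolution `⋯ ⟶ X₁ ⟶ X₀ ⟶ M ⟶ 0` of `M`: the terms `Xᵢ` lie in `X`, and the
augmented complex becomes acyclic under `Hom(D, -)` for every `D` in `X`. -/
structure LeftResolution (X : ObjectProperty C) (M : C) where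
  /-- the deleted resolution `⋯ ⟶ X₁ ⟶ X₀ ⟶ 0` -/
  complex : ChainComplex C ℕ
  /-- the augmentation `X₀ ⟶ M` -/
  ε : complex.X 0 ⟶ M
  d_comp_ε : complex.d 1 0 ≫ ε = 0
  mem (i : ℕ) : X (complex.X i)
  acyclic : HomFromAcyclic X (complex.augment ε d_comp_ε)

/-- The augmented complex `⋯ ⟶ X₁ ⟶ X₀ ⟶ M ⟶ 0` (with `M` in degree `0`). -/
noncomputable abbrev LeftResolution.augmented {X : ObjectProperty C} {M : C}
    (P : LeftResolution X M) : ChainComplex C ℕ :=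
  P.complex.augment P.ε P.d_comp_ε

/-- A right `Y`-coresolution `0 ⟶ N ⟶ Y⁰ ⟶ Y¹ ⟶ ⋯` of `N`: the terms `Yⁱ` lie in `Y`, and
the augmented complex becomes acyclic under `Hom(-, D)` for every `D` in `Y`. -/
structure RightCoresolution (Y : ObjectProperty C) (N : C) where
  /-- the deleted coresolution `0 ⟶ Y⁰ ⟶ Y¹ ⟶ ⋯` -/
  complex : CochainComplex C ℕ
  /-- the coaugmentation `N ⟶ Y⁰` -/
  η : N ⟶ complex.X 0
  η_comp_d : η ≫ complex.d 0 1 = 0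
  mem (i : ℕ) : Y (complex.X i)
  acyclic : HomToAcyclic Y (complex.augment η η_comp_d)

/-- The augmented complex `0 ⟶ N ⟶ Y⁰ ⟶ Y¹ ⟶ ⋯` (with `N` in degree `0`). -/
noncomputable abbrev RightCoresolution.augmented {Y : ObjectProperty C} {N : C}
    (Q : RightCoresolution Y N) : CochainComplex C ℕ :=
  Q.complex.augment Q.η Q.η_comp_d

/-- The left `X`-dimension of `M`: the infimum (`⊤` if there is none) of the `n` for which there
is an exact sequence `0 ⟶ Xₙ ⟶ ⋯ ⟶ X₀ ⟶ M ⟶ 0` that is a left `X`-resolution of `M`. -/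
noncomputable def leftDim (X : ObjectProperty C) (M : C) : ℕ∞ :=
  ⨅ n ∈ {n : ℕ | ∃ P : LeftResolution X M,
    (∀ i, n < i → IsZero (P.complex.X i)) ∧ P.augmented.Acyclic}, (n : ℕ∞)

/-- `f : D ⟶ M` is a right `X`-approximation of `M`. -/
def IsRightApprox (X : ObjectProperty C) {D M : C} (f : D ⟶ M) : Prop :=
  X D ∧ ∀ ⦃D' : C⦄, X D' → ∀ g : D' ⟶ M, ∃ h : D' ⟶ D, h ≫ f = g

/-- `f : M ⟶ D` is a left `Y`-approximation of `M`. -/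
def IsLeftApprox (Y : ObjectProperty C) {M D : C} (f : M ⟶ D) : Prop :=
  Y D ∧ ∀ ⦃D' : C⦄, Y D' → ∀ g : M ⟶ D', ∃ h : D ⟶ D', f ≫ h = g

/-- Every object has a right `X`-approximation. -/
def ContravariantlyFinite (X : ObjectProperty C) : Prop :=
  ∀ M : C, ∃ (D : C) (f : D ⟶ M), IsRightApprox X f

/-- Every object has a left `Y`-approximation. -/
def CovariantlyFinite (Y : ObjectProperty C) : Prop :=
  ∀ M : C, ∃ (D : C) (f : M ⟶ D), IsLeftApprox Y f

/-- Full additive subcategories, taken closed under isomorphism. -/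
structure IsAdditiveSubcategory (X : ObjectProperty C) : Prop where
  iso : X.IsClosedUnderIsomorphisms
  products : X.IsClosedUnderFiniteProducts

/-- Balanced pairs of additive subcategories. -/
structure IsBalancedPair (X Y : ObjectProperty C) : Prop where
  additive_left : IsAdditiveSubcategory X
  additive_right : IsAdditiveSubcategory Y
  contravariantlyFinite : ContravariantlyFinite X
  covariantlyFinite : CovariantlyFinite Y
  exists_resolution (M : C) : ∃ P : LeftResolution X M, HomToAcyclic Y P.augmented
  exists_coresolution (N : C) : ∃ Q : RightCoresolution Y N, HomFromAcyclic X Q.augmented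

/-- A balanced pair `(X, Y)` is admissible if every right `X`-approximation is an epimorphism. -/
structure IsAdmissibleBalancedPair (X Y : ObjectProperty C) : Prop
    extends IsBalancedPair X Y where
  admissible ⦃D M : C⦄ (f : D ⟶ M) : IsRightApprox X f → Epi f

/-- A chosen left `X`-resolution of `M`, for a balanced pair `(X, Y)`. -/
noncomputable def IsBalancedPair.resolution {X Y : ObjectProperty C} (h : IsBalancedPair X Y)
    (M : C) : LeftResolution X M :=
  (h.exists_resolution M).choose

/-- `Ext^i_X(M, N)`, relative to a balanced pair `(X, Y)`: the `i`-th cohomology of `Hom(P, N)`,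
where `P` is the deleted complex of a left `X`-resolution of `M`. Up to isomorphism the choice of
the resolution does not matter. -/
noncomputable def IsBalancedPair.relExt {X Y : ObjectProperty C} (h : IsBalancedPair X Y)
    (i : ℕ) (M N : C) : AddCommGrpCat.{v} :=
  (((preadditiveYoneda.obj N).mapHomologicalComplex _).obj (h.resolution M).complex.op).homology i

/-- `T` is partial `n`-`X`-tilting with respect to the admissible balanced pair `(X, Y)`: the left
`X`-dimension of `T` is at most `n`, and `Ext^i_X(T, T^(I)) = 0` for all `i > 0` and all sets `I`
such that the coproduct `T^(I)` of `I` copies of `T` exists. -/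
structure IsPartialTilting {X Y : ObjectProperty C} (h : IsAdmissibleBalancedPair X Y) (n : ℕ)
    (T : C) : Prop where
  leftDim_le : leftDim X T ≤ n
  selfOrthogonal (I : Type w) (c : Cofan (fun _ : I => T)) (hc : IsColimit c) (i : ℕ) :
    0 < i → IsZero (h.toIsBalancedPair.relExt i T c.pt)

end Abelian

/-- A recollement of the abelian category `A` by the abelian categories `A'` and `A''`. -/
structure Recollement (A' : Type u₁) [Category.{v₁} A'] [Abelian A']
    (A : Type u₂) [Category.{v₂} A] [Abelian A]
    (A'' : Type u₃) [Category.{v₃} A''] [Abelian A''] where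
  /-- `i^*` -/
  iUpperStar : A ⥤ A'
  /-- `i_*` -/
  iLowerStar : A' ⥤ A
  /-- `i^!` -/
  iUpperShriek : A ⥤ A'
  /-- `j_!` -/
  jLowerShriek : A'' ⥤ A
  /-- `j^*` -/
  jUpperStar : A ⥤ A''
  /-- `j_*` -/
  jLowerStar : A'' ⥤ A
  iUpperStar_additive : iUpperStar.Additive
  iLowerStar_additive : iLowerStar.Additive
  iUpperShriek_additive : iUpperShriek.Additive
  jLowerShriek_additive : jLowerShriek.Additive
  jUpperStar_additive : jUpperStar.Additive
  jLowerStar_additive : jLowerStar.Additive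
  /-- `(i^*, i_*)` is an adjoint pair -/
  iAdj₁ : iUpperStar ⊣ iLowerStar
  /-- `(i_*, i^!)` is an adjoint pair -/
  iAdj₂ : iLowerStar ⊣ iUpperShriek
  /-- `(j_!, j^*)` is an adjoint pair -/
  jAdj₁ : jLowerShriek ⊣ jUpperStar
  /-- `(j^*, j_*)` is an adjoint pair -/
  jAdj₂ : jUpperStar ⊣ jLowerStar
  iLowerStar_full : iLowerStar.Full
  iLowerStar_faithful : iLowerStar.Faithful
  jLowerShriek_full : jLowerShriek.Full
  jLowerShriek_faithful : jLowerShriek.Faithful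
  jLowerStar_full : jLowerStar.Full
  jLowerStar_faithful : jLowerStar.Faithful
  /-- `Im i_* = Ker j^*` -/
  essImage_iff (B : A) : iLowerStar.essImage B ↔ IsZero (jUpperStar.obj B)

section Glue

variable {A' : Type u₁} [Category.{v₁} A'] [Abelian A']
  {A : Type u₂} [Category.{v₂} A] [Abelian A]
  {A'' : Type u₃} [Category.{v₃} A''] [Abelian A'']

/-- `{X ∈ A | i^* X ∈ X', j^* X ∈ X''}` -/
def Recollement.glueLeft (R : Recollement A' A A'') (X' : ObjectProperty A')
    (X'' : ObjectProperty A'') : ObjectProperty A :=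
  fun B => X' (R.iUpperStar.obj B) ∧ X'' (R.jUpperStar.obj B)

/-- `{Y ∈ A | i^! Y ∈ Y', j^* Y ∈ Y''}` -/
def Recollement.glueRight (R : Recollement A' A A'') (Y' : ObjectProperty A')
    (Y'' : ObjectProperty A'') : ObjectProperty A :=
  fun B => Y' (R.iUpperShriek.obj B) ∧ Y'' (R.jUpperStar.obj B)

end Glue

end RelTilt

/-! Resolve `T'` by `P'` and `T''` by `P''`; the claim is that `i_* P' ⊕ j_! P''` is a left
`X`-resolution of `T = i_* T' ⊕ j_! T''`, whose length gives the dimension bound and which also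
computes `Ext`. For `i_* P'` the required `Hom(D, -)`-acyclicity is the adjunction `(i^*, i_*)`. For
`j_! P''` no adjunction applies on that side. Instead, exactness of `i^*` makes `j_!` exact, so `j_!
P''` is acyclic; `Hom(j_! P'', D) = Hom(P'', j^* D)` is acyclic for `D` in `Y`; and in an admissible
balanced pair, `Y`-acyclicity of an acyclic complex implies `X`-acyclicity
(`homFromAcyclic_of_homToAcyclic`). For `Ext`, let `N` be a coproduct of copies of `T`. As left
adjoints, `i^*` and `j^*` send `N` to coproducts of copies of `T'` and `T''`. The `j_!` half is
`Hom(P'', j^* N)`. For the `i_*` half, adjunction would give the uncontrolled object `i^! N`;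
instead the unit `N ⟶ i_* i^* N` splits, and since `i^*` is faithful on maps out of `i_* M`,
exactness of `Hom(P', i^* N)` transfers to `Hom(i_* P', N)` (`homToExactAt_iLowerStar`). -/

namespace RelTilt

/-! ### Hom-exactness by elements, and passing from `Y`-acyclic to `X`-acyclic. -/

section HomExactness

variable {C : Type u} [Category.{v} C] [Abelian C] {ι : Type*} {c : ComplexShape ι}

/-- `Hom(D, K)` is exact at `j`, expressed in terms of morphisms. -/
def HomFromExactAt (D : C) (K : HomologicalComplex C c) (j : ι) : Prop :=
  ∀ f : D ⟶ K.X j, f ≫ K.d j (c.next j) = 0 →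
    ∃ g : D ⟶ K.X (c.prev j), g ≫ K.d (c.prev j) j = f

/-- `Hom(K, D)` is exact at `j`, expressed in terms of morphisms. -/
def HomToExactAt (K : HomologicalComplex C c) (D : C) (j : ι) : Prop :=
  ∀ f : K.X j ⟶ D, K.d (c.prev j) j ≫ f = 0 →
    ∃ g : K.X (c.next j) ⟶ D, K.d j (c.next j) ≫ g = f

lemma homFromExactAt_iff (D : C) (K : HomologicalComplex C c) {i j k : ι} (hi : c.prev j = i)
    (hk : c.next j = k) : HomFromExactAt D K j ↔
      ∀ f : D ⟶ K.X j, f ≫ K.d j k = 0 → ∃ g : D ⟶ K.X i, g ≫ K.d i j = f := by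
  subst hi hk
  rfl

lemma homToExactAt_iff (K : HomologicalComplex C c) (D : C) {i j k : ι} (hi : c.prev j = i)
    (hk : c.next j = k) : HomToExactAt K D j ↔
      ∀ f : K.X j ⟶ D, K.d i j ≫ f = 0 → ∃ g : K.X k ⟶ D, K.d j k ≫ g = f := by
  subst hi hk
  rfl

lemma exactAt_preadditiveCoyoneda_iff (D : C) (K : HomologicalComplex C c) (j : ι) :
    (((preadditiveCoyoneda.obj (op D)).mapHomologicalComplex c).obj K).ExactAt j ↔
      HomFromExactAt D K j := by
  rw [HomologicalComplex.exactAt_iff' _ _ j _ rfl rfl, ShortComplex.ab_exact_iff]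
  rfl

lemma exactAt_preadditiveYoneda_iff (K : HomologicalComplex C c) (D : C) (j : ι) :
    (((preadditiveYoneda.obj D).mapHomologicalComplex c.symm).obj K.op).ExactAt j ↔
      HomToExactAt K D j := by
  rw [HomologicalComplex.exactAt_iff' _ (c.next j) j (c.prev j) rfl rfl,
    ShortComplex.ab_exact_iff]
  rfl

lemma homFromAcyclic_iff (X : ObjectProperty C) (K : HomologicalComplex C c) :
    HomFromAcyclic X K ↔ ∀ D, X D → ∀ j, HomFromExactAt D K j :=
  forall₂_congr fun D _ => forall_congr' fun j => exactAt_preadditiveCoyoneda_iff D K j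

lemma homToAcyclic_iff (Y : ObjectProperty C) (K : HomologicalComplex C c) :
    HomToAcyclic Y K ↔ ∀ D, Y D → ∀ j, HomToExactAt K D j :=
  forall₂_congr fun D _ => forall_congr' fun j => exactAt_preadditiveYoneda_iff K D j

lemma HomToExactAt.of_homotopy {K L : HomologicalComplex C c} {f : K ⟶ L} {g : L ⟶ K}
    (h : Homotopy (f ≫ g) (𝟙 K)) {D : C} {j : ι} (hL : HomToExactAt L D j) :
    HomToExactAt K D j := by
  intro φ hφ
  obtain ⟨ψ, hψ⟩ := hL (g.f j ≫ φ) (by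
    rw [← Category.assoc, ← g.comm, Category.assoc, hφ, comp_zero])
  have hc : f.f j ≫ g.f j = K.d j (c.next j) ≫ h.hom (c.next j) j +
      h.hom j (c.prev j) ≫ K.d (c.prev j) j + 𝟙 (K.X j) := h.comm j
  -- The homotopy term ending in `d` dies on the cocycle `φ`; the other one is subtracted here.
  refine ⟨f.f (c.next j) ≫ ψ - h.hom (c.next j) j ≫ φ, ?_⟩
  have h1 : K.d j (c.next j) ≫ f.f (c.next j) ≫ ψ = (f.f j ≫ g.f j) ≫ φ := by
    rw [← Category.assoc, ← f.comm, Category.assoc, hψ, Category.assoc]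
  rw [Preadditive.comp_sub, h1, hc]
  simp [hφ]

lemma IsAdmissibleBalancedPair.exists_epi {X Y : ObjectProperty C}
    (h : IsAdmissibleBalancedPair X Y) (M : C) : ∃ (D : C) (f : D ⟶ M), X D ∧ Epi f := by
  obtain ⟨D, f, hf⟩ := h.contravariantlyFinite M
  exact ⟨D, f, hf.1, h.admissible f hf⟩

/-- In an admissible pair, complexes which are `X`-acyclic are acyclic. -/
lemma IsAdmissibleBalancedPair.acyclic {X Y : ObjectProperty C}
    (h : IsAdmissibleBalancedPair X Y) {K : HomologicalComplex C c} (hK : HomFromAcyclic X K) :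
    K.Acyclic := by
  rw [homFromAcyclic_iff] at hK
  intro j
  rw [K.exactAt_iff_exact_up_to_refinements _ j _ rfl rfl]
  intro A x hx
  obtain ⟨D, e, hD, he⟩ := h.exists_epi A
  obtain ⟨g, hg⟩ := hK D hD j (e ≫ x) (by rw [Category.assoc, hx, comp_zero])
  exact ⟨D, e, he, g, hg.symm⟩

/-- Augmenting shifts degrees by one: exactness in degrees 0, 1, 2 concerns `N`, `Y⁰`, `Y¹`. -/
lemma RightCoresolution.homFrom_exact_zero {X Y : ObjectProperty C} {N D : C}
    (Q : RightCoresolution Y N) (hQ : HomFromAcyclic X Q.augmented) (hD : X D) (f : D ⟶ N)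
    (hf : f ≫ Q.η = 0) : f = 0 := by
  have h0 := (homFromAcyclic_iff _ _).1 hQ D hD 0
  rw [homFromExactAt_iff _ _ (CochainComplex.prev_nat_zero) (CochainComplex.next ℕ 0)] at h0
  obtain ⟨g, hg⟩ := h0 f hf
  rw [← hg, Q.augmented.shape 0 0 (by simp), comp_zero]
  rfl

lemma RightCoresolution.homFrom_exact_one {X Y : ObjectProperty C} {N D : C}
    (Q : RightCoresolution Y N) (hQ : HomFromAcyclic X Q.augmented) (hD : X D)
    (f : D ⟶ Q.complex.X 0) (hf : f ≫ Q.complex.d 0 1 = 0) : ∃ g, g ≫ Q.η = f := by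
  have h0 := (homFromAcyclic_iff _ _).1 hQ D hD 1
  rw [homFromExactAt_iff _ _ (CochainComplex.prev_nat_succ _) (CochainComplex.next ℕ _)] at h0
  exact h0 f hf

lemma RightCoresolution.homFrom_exact_two {X Y : ObjectProperty C} {N D : C}
    (Q : RightCoresolution Y N) (hQ : HomFromAcyclic X Q.augmented) (hD : X D)
    (f : D ⟶ Q.complex.X 1) (hf : f ≫ Q.complex.d 1 2 = 0) :
    ∃ g, g ≫ Q.complex.d 0 1 = f := by
  have h0 := (homFromAcyclic_iff _ _).1 hQ D hD 2
  rw [homFromExactAt_iff _ _ (CochainComplex.prev_nat_succ _) (CochainComplex.next ℕ _)] at h0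
  exact h0 f hf

/-- For an admissible balanced pair `(X, Y)`, short exact sequences which stay exact under
`Hom(-, Y)` stay exact under `Hom(X, -)`. -/
lemma IsAdmissibleBalancedPair.exists_lift_of_exists_extension {X Y : ObjectProperty C}
    (h : IsAdmissibleBalancedPair X Y) {S : ShortComplex C} (hS : S.ShortExact)
    (hY : ∀ D, Y D → ∀ f : S.X₁ ⟶ D, ∃ g : S.X₂ ⟶ D, S.f ≫ g = f)
    {D : C} (hD : X D) (f : D ⟶ S.X₃) : ∃ g : D ⟶ S.X₂, g ≫ S.g = f := by
  have := hS.mono_f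
  have := hS.epi_g
  obtain ⟨Q, hQ⟩ := h.exists_coresolution S.X₁
  -- Map `S` to the start of the coresolution: `η` extends to `β`, and `β ≫ d` descends to `γ`.
  obtain ⟨β, hβ⟩ := hY _ (Q.mem 0) Q.η
  obtain ⟨γ, hγ⟩ : ∃ γ : S.X₃ ⟶ Q.complex.X 1, S.g ≫ γ = β ≫ Q.complex.d 0 1 :=
    ⟨hS.exact.desc (β ≫ Q.complex.d 0 1) (by rw [← Category.assoc, hβ, Q.η_comp_d]),
      hS.exact.g_desc _ _⟩
  have hγd : γ ≫ Q.complex.d 1 2 = 0 := by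
    rw [← cancel_epi S.g, ← Category.assoc, hγ]
    simp
  obtain ⟨α, hα⟩ := Q.homFrom_exact_two hQ hD (f ≫ γ) (by rw [Category.assoc, hγd, comp_zero])
  -- A lift `b` of `f` exists after the cover `e : E ⟶ D`. Correcting it by a map into `S.X₁` makes
  -- it compatible with `α`, which forces it to descend along `e`.
  obtain ⟨E, p, hE, hp⟩ := h.exists_epi (pullback S.g f)
  let e : E ⟶ D := p ≫ pullback.snd S.g f
  have he : Epi e := epi_comp _ _
  let b : E ⟶ S.X₂ := p ≫ pullback.fst S.g f
  have hb : b ≫ S.g = e ≫ f := by simp [b, e, pullback.condition]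
  obtain ⟨a, ha⟩ := Q.homFrom_exact_one hQ hE (e ≫ α - b ≫ β) (by
    rw [Preadditive.sub_comp, Category.assoc, hα, Category.assoc b, ← hγ, reassoc_of% hb, sub_self])
  let b' : E ⟶ S.X₂ := b + a ≫ S.f
  have hb' : b' ≫ S.g = e ≫ f := by simp [b', hb]
  have hb'β : b' ≫ β = e ≫ α := by simp [b', hβ, ha]
  -- On `kernel e` the map `b'` lands in `S.X₁` and is killed by `η`, which is injective on maps
  -- from objects of `X`.
  have hker : kernel.ι e ≫ b' = 0 := by
    obtain ⟨G, q, hG, hq⟩ := h.exists_epi (kernel e)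
    rw [← cancel_epi q, comp_zero]
    have h1 : (q ≫ kernel.ι e ≫ b') ≫ S.g = 0 := by simp [hb']
    have h2 : hS.exact.lift _ h1 = 0 := by
      refine Q.homFrom_exact_zero hQ hG _ ?_
      rw [← hβ, ← Category.assoc, hS.exact.lift_f]
      simp [hb'β]
    rw [← hS.exact.lift_f _ h1, h2, zero_comp]
  refine ⟨Abelian.epiDesc e b' hker, ?_⟩
  rw [← cancel_epi e, ← Category.assoc, Abelian.comp_epiDesc, hb']

/-- For an admissible balanced pair `(X, Y)`, acyclic complexes which stay acyclic under
`Hom(-, Y)` stay acyclic under `Hom(X, -)`. -/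
lemma IsAdmissibleBalancedPair.homFromAcyclic_of_homToAcyclic {X Y : ObjectProperty C}
    (h : IsAdmissibleBalancedPair X Y) {K : ChainComplex C ℕ} (hK : K.Acyclic)
    (hY : HomToAcyclic Y K) : HomFromAcyclic X K := by
  rw [homToAcyclic_iff] at hY
  have hex (i j k : ℕ) (hi : (ComplexShape.down ℕ).prev j = i)
      (hk : (ComplexShape.down ℕ).next j = k) : (K.sc' i j k).Exact :=
    (K.exactAt_iff' _ _ _ hi hk).1 (hK j)
  rw [homFromAcyclic_iff]
  intro D hD j f hf
  obtain ⟨i, hi⟩ : ∃ i, i = (ComplexShape.down ℕ).prev j := ⟨_, rfl⟩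
  obtain ⟨k, hk⟩ : ∃ k, k = (ComplexShape.down ℕ).next j := ⟨_, rfl⟩
  rw [← hk] at hf
  rw [← hi]
  have hij : i = j + 1 := by rw [hi, ChainComplex.prev]
  have hni : (ComplexShape.down ℕ).next i = j := by rw [hij, ChainComplex.next_nat_succ]
  let p : K.X i ⟶ kernel (K.d j k) := kernel.lift _ (K.d i j) (K.d_comp_d _ _ _)
  have hpι : p ≫ kernel.ι (K.d j k) = K.d i j := kernel.lift_ι _ _ _
  have hp : Epi p := (hex i j k hi.symm hk.symm).epi_kernelLift
  -- Lifting through `d : K_{j+1} ⟶ K_j` is lifting through the sequence of cycles `Z_{j+1} ⟶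
  -- K_{j+1} ⟶ Z_j`. For `j = 0`, `next` is 0 with zero differential, so `Z_0` is `K_0`.
  let S : ShortComplex C := ShortComplex.mk (kernel.ι (K.d i j)) p (by
    rw [← cancel_mono (kernel.ι (K.d j k)), Category.assoc, hpι]; simp)
  have hS : S.ShortExact :=
    { exact := by
        apply ShortComplex.exact_of_f_is_kernel
        refine KernelFork.IsLimit.ofι' _ _ fun {A} x hx => ⟨kernel.lift _ x ?_, kernel.lift_ι _ _ _⟩
        have hx' : x ≫ p = 0 := hx
        rw [← hpι, reassoc_of% hx', zero_comp]
      mono_f := inferInstanceAs (Mono (kernel.ι (K.d i j)))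
      epi_g := hp }
  -- Extending `φ` from `Z_{j+1}` to `K_{j+1}`: its composite with the epi `K_{j+2} ⟶ Z_{j+1}` is a
  -- cocycle, hence a coboundary.
  obtain ⟨g, hg⟩ := h.exists_lift_of_exists_extension hS (fun E hE φ => by
    let l := (ComplexShape.down ℕ).prev i
    let q : K.X l ⟶ kernel (K.d i j) := kernel.lift _ (K.d l i) (K.d_comp_d _ _ _)
    have hq : Epi q := (hex l i j rfl hni).epi_kernelLift
    have hqι : q ≫ kernel.ι (K.d i j) = K.d l i := kernel.lift_ι _ _ _
    have hqd : K.d ((ComplexShape.down ℕ).prev l) l ≫ q = 0 := by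
      rw [← cancel_mono (kernel.ι (K.d i j)), Category.assoc, hqι]; simp
    have hl : (ComplexShape.down ℕ).next l = i := by
      rw [show l = i + 1 from ChainComplex.prev ℕ i, ChainComplex.next_nat_succ]
    obtain ⟨ψ, hψ⟩ := (homToExactAt_iff _ _ rfl hl).1 (hY E hE l) (q ≫ φ)
      (by rw [reassoc_of% hqd, zero_comp])
    refine ⟨ψ, ?_⟩
    rw [← cancel_epi q, ← Category.assoc]
    exact (congrArg (· ≫ ψ) hqι).trans hψ) hD (kernel.lift _ f hf)
  refine ⟨g, ?_⟩
  rw [← hpι, ← Category.assoc]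
  exact (congrArg (· ≫ kernel.ι (K.d j k)) hg).trans (kernel.lift_ι _ _ _)

end HomExactness

/-! ### Comparison theorem for augmented resolutions. -/

section Comparison

variable {C : Type u} [Category.{v} C] [Abelian C] {X : ObjectProperty C}
  {K L : ChainComplex C ℕ}

lemma exists_lift_zero (hL : HomFromAcyclic X L) {D : C} (hD : X D) (f : D ⟶ L.X 0) :
    ∃ g : D ⟶ L.X 1, g ≫ L.d 1 0 = f := by
  have := (homFromAcyclic_iff _ _).1 hL D hD 0
  rw [homFromExactAt_iff _ _ (ChainComplex.prev ℕ 0) (ChainComplex.next_nat_zero)] at this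
  exact this f (by rw [L.shape 0 0 (by simp), comp_zero])

lemma exists_lift_succ (hL : HomFromAcyclic X L) {D : C} (hD : X D) {n : ℕ}
    (f : D ⟶ L.X (n + 1)) (hf : f ≫ L.d (n + 1) n = 0) :
    ∃ g : D ⟶ L.X (n + 2), g ≫ L.d (n + 2) (n + 1) = f := by
  have := (homFromAcyclic_iff _ _).1 hL D hD (n + 1)
  rw [homFromExactAt_iff _ _ (ChainComplex.prev ℕ _) (ChainComplex.next_nat_succ n)] at this
  exact this f hf

/-- Degree 0 carries the resolved object, so only the later terms need lie in `X`. -/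
lemma exists_chainMap (hK : ∀ i, X (K.X (i + 1))) (hL : HomFromAcyclic X L)
    (f : K.X 0 ⟶ L.X 0) : ∃ φ : K ⟶ L, φ.f 0 = f := by
  have h1 := exists_lift_zero hL (hK 0) (K.d 1 0 ≫ f)
  refine ⟨ChainComplex.mkHom K L f h1.choose h1.choose_spec fun n p => ?_, rfl⟩
  have h2 := exists_lift_succ hL (hK (n + 1)) (K.d (n + 2) (n + 1) ≫ p.2.1) (by
    rw [Category.assoc, p.2.2]; simp)
  exact ⟨h2.choose, h2.choose_spec⟩

lemma nonempty_homotopy_zero (hK : ∀ i, X (K.X (i + 1))) (hL : HomFromAcyclic X L)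
    (φ : K ⟶ L) (hφ : φ.f 0 = 0) : Nonempty (Homotopy φ 0) := by
  have h1 := exists_lift_succ hL (hK 0) (φ.f 1) (by rw [φ.comm, hφ, comp_zero])
  refine ⟨Homotopy.mkInductive φ 0 (by simp [hφ]) h1.choose (by simpa using h1.choose_spec.symm)
    fun n p => ?_⟩
  have h2 := exists_lift_succ hL (hK (n + 1)) (φ.f (n + 2) - K.d (n + 2) (n + 1) ≫ p.2.1) (by
    have hp := p.2.2
    rw [Preadditive.sub_comp, φ.comm, Category.assoc, ← Preadditive.comp_sub,
      sub_eq_of_eq_add hp]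
    simp)
  exact ⟨h2.choose, by rw [h2.choose_spec]; simp⟩

/-- Comparison of two `X`-resolutions, viewed as augmented complexes, of the same object. -/
lemma HomToExactAt.of_iso_zero (hK : ∀ i, X (K.X (i + 1))) (hL : ∀ i, X (L.X (i + 1)))
    (hK' : HomFromAcyclic X K) (hL' : HomFromAcyclic X L) (e : K.X 0 ≅ L.X 0) {D : C} {j : ℕ}
    (h : HomToExactAt L D j) : HomToExactAt K D j := by
  obtain ⟨f, hf⟩ := exists_chainMap hK hL' e.hom
  obtain ⟨g, hg⟩ := exists_chainMap hL hK' e.inv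
  obtain ⟨s⟩ := nonempty_homotopy_zero hK hK' (f ≫ g - 𝟙 K) (by simp [hf, hg])
  exact h.of_homotopy ((Homotopy.equivSubZero).symm s)

end Comparison

/-! ### Relative `Ext` and dimension read off augmented complexes. -/

section Resolutions

variable {C : Type u} [Category.{v} C] [Abelian C] {X Y : ObjectProperty C}

/-- The left resolution given by an `X`-acyclic complex with terms in `X` in positive degrees. -/
noncomputable def LeftResolution.ofAugmented (K : ChainComplex C ℕ) (hK : ∀ i, X (K.X (i + 1)))
    (hK' : HomFromAcyclic X K) : LeftResolution X (K.X 0) where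
  complex := ChainComplex.truncate.obj K
  ε := K.d 1 0
  d_comp_ε := K.d_comp_d _ _ _
  mem := hK
  acyclic := by
    rw [homFromAcyclic_iff]
    intro D hD j
    match j with
    | 0 =>
      rw [homFromExactAt_iff _ _ (ChainComplex.prev ℕ 0) (ChainComplex.next_nat_zero)]
      exact fun f _ => exists_lift_zero hK' hD f
    | 1 =>
      rw [homFromExactAt_iff _ _ (ChainComplex.prev ℕ 1) (ChainComplex.next_nat_succ 0)]
      exact fun f hf => exists_lift_succ hK' hD f hf
    | n + 2 =>
      rw [homFromExactAt_iff _ _ (ChainComplex.prev ℕ _) (ChainComplex.next_nat_succ (n + 1))]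
      exact fun f hf => exists_lift_succ hK' hD f hf

/-- Positivity is needed: at `i = 0` the augmented complex continues to `M`, the deleted one stops.
-/
lemma homToExactAt_augmented_succ {M : C} (P : LeftResolution X M) (N : C) {i : ℕ} (hi : 0 < i) :
    HomToExactAt P.augmented N (i + 1) ↔ HomToExactAt P.complex N i := by
  obtain ⟨i, rfl⟩ := Nat.exists_eq_add_one.2 hi
  rw [homToExactAt_iff _ _ (ChainComplex.prev ℕ _) (ChainComplex.next_nat_succ (i + 1)),
    homToExactAt_iff _ _ (ChainComplex.prev ℕ _) (ChainComplex.next_nat_succ i)]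
  rfl

lemma isZero_relExt_iff (h : IsBalancedPair X Y) {i : ℕ} (hi : 0 < i) (M N : C) :
    IsZero (h.relExt i M N) ↔ HomToExactAt (h.resolution M).augmented N (i + 1) := by
  rw [homToExactAt_augmented_succ _ _ hi, ← exactAt_preadditiveYoneda_iff]
  exact (HomologicalComplex.exactAt_iff_isZero_homology _ _).symm

lemma isZero_relExt_of_augmented (h : IsBalancedPair X Y) {i : ℕ} (hi : 0 < i) {M N : C}
    (K : ChainComplex C ℕ) (hK : ∀ i, X (K.X (i + 1))) (hK' : HomFromAcyclic X K)
    (e : M ≅ K.X 0) (hN : HomToExactAt K N (i + 1)) : IsZero (h.relExt i M N) := by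
  rw [isZero_relExt_iff h hi]
  exact hN.of_iso_zero (h.resolution M).mem hK (h.resolution M).acyclic hK' e

/-- A finite infimum in `ℕ∞` is attained, and a resolution of length `m ≤ n` also has length at most
`n`. -/
lemma exists_of_leftDim_le {M : C} {n : ℕ} (hM : leftDim X M ≤ n) :
    ∃ P : LeftResolution X M, (∀ i, n < i → IsZero (P.complex.X i)) ∧ P.augmented.Acyclic := by
  by_contra! hP
  have : (n + 1 : ℕ∞) ≤ leftDim X M := by
    refine le_iInf₂ fun m hm => ?_
    obtain ⟨P, hP1, hP2⟩ := hm
    by_contra! hlt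
    have hmn : m ≤ n := by
      have : m < n + 1 := by exact_mod_cast hlt
      omega
    exact hP P (fun i hi => hP1 i (by omega)) hP2
  have h2 := this.trans hM
  have : n + 1 ≤ n := by exact_mod_cast h2
  omega

lemma leftDim_le_of_augmented (h : IsAdmissibleBalancedPair X Y) {n : ℕ} (K : ChainComplex C ℕ)
    (hK : ∀ i, X (K.X (i + 1))) (hK' : HomFromAcyclic X K)
    (hn : ∀ i, n < i → IsZero (K.X (i + 1))) : leftDim X (K.X 0) ≤ n :=
  iInf₂_le n ⟨LeftResolution.ofAugmented K hK hK', hn, h.acyclic (LeftResolution.acyclic _)⟩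

/-- For a balanced pair `(X, Y)`, every left `X`-resolution stays acyclic under `Hom(-, Y)`. -/
lemma IsBalancedPair.homToAcyclic (h : IsBalancedPair X Y) {M : C} (P : LeftResolution X M) :
    HomToAcyclic Y P.augmented := by
  obtain ⟨Q, hQ⟩ := h.exists_resolution M
  rw [homToAcyclic_iff] at hQ ⊢
  exact fun D hD j => (hQ D hD j).of_iso_zero P.mem Q.mem P.acyclic Q.acyclic (Iso.refl M)

end Resolutions

section Additive

variable {C : Type u} [Category.{v} C]

lemma IsAdditiveSubcategory.zero {X : ObjectProperty C} (hX : IsAdditiveSubcategory X) {Z : C}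
    (hZ : IsZero Z) : X Z := by
  have := hX.products
  exact X.prop_of_isTerminal Z hZ.isTerminal

lemma IsAdditiveSubcategory.of_iso {X : ObjectProperty C} (hX : IsAdditiveSubcategory X) {M N : C}
    (e : M ≅ N) (hM : X M) : X N := by
  have := hX.iso
  exact X.prop_of_iso e hM

end Additive

/-! ### Termwise biproducts of complexes. -/

section Biprod

variable {C : Type u} [Category.{v} C] [Abelian C] {ι : Type*} {c : ComplexShape ι}

/-- The termwise biproduct of two complexes. -/
noncomputable def biprodComplex (K L : HomologicalComplex C c) : HomologicalComplex C c where
  X i := K.X i ⊞ L.X i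
  d i j := biprod.map (K.d i j) (L.d i j)
  shape i j hij := by
    rw [K.shape i j hij, L.shape i j hij]
    ext <;> simp
  d_comp_d' i j k _ _ := by
    ext <;> simp

lemma HomFromAcyclic.biprod {X : ObjectProperty C} {K L : HomologicalComplex C c}
    (hK : HomFromAcyclic X K) (hL : HomFromAcyclic X L) :
    HomFromAcyclic X (biprodComplex K L) := by
  rw [homFromAcyclic_iff] at *
  intro D hD j (f : D ⟶ K.X j ⊞ L.X j) hf
  change f ≫ biprod.map _ _ = 0 at hf
  obtain ⟨g₁, h₁⟩ := hK D hD j (f ≫ biprod.fst) (by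
    rw [Category.assoc, ← biprod.map_fst _ (L.d j (c.next j)), reassoc_of% hf, zero_comp])
  obtain ⟨g₂, h₂⟩ := hL D hD j (f ≫ biprod.snd) (by
    rw [Category.assoc, ← biprod.map_snd (K.d j (c.next j)), reassoc_of% hf, zero_comp])
  refine ⟨biprod.lift g₁ g₂, ?_⟩
  change biprod.lift g₁ g₂ ≫ biprod.map _ _ = f
  apply biprod.hom_ext
  · simpa using h₁
  · simpa using h₂

lemma HomToExactAt.biprod {K L : HomologicalComplex C c} {D : C} {j : ι}
    (hK : HomToExactAt K D j) (hL : HomToExactAt L D j) :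
    HomToExactAt (biprodComplex K L) D j := by
  intro (f : K.X j ⊞ L.X j ⟶ D) hf
  change biprod.map _ _ ≫ f = 0 at hf
  obtain ⟨g₁, h₁⟩ := hK (biprod.inl ≫ f) (by
    rw [← Category.assoc, ← biprod.inl_map _ (L.d (c.prev j) j), Category.assoc, hf, comp_zero])
  obtain ⟨g₂, h₂⟩ := hL (biprod.inr ≫ f) (by
    rw [← Category.assoc, ← biprod.inr_map (K.d (c.prev j) j), Category.assoc, hf, comp_zero])
  refine ⟨biprod.desc g₁ g₂, ?_⟩
  change biprod.map _ _ ≫ biprod.desc g₁ g₂ = f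
  apply biprod.hom_ext'
  · simpa using h₁
  · simpa using h₂

lemma IsAdditiveSubcategory.biprod {X : ObjectProperty C} (hX : IsAdditiveSubcategory X) {M N : C}
    (hM : X M) (hN : X N) : X (M ⊞ N) := by
  have := hX.products
  exact X.prop_of_isLimit_binaryFan (BinaryBiproduct.isLimit M N) hM hN

end Biprod

/-- The image of a constant coproduct under a left adjoint, up to an isomorphism of the summand. -/
noncomputable def isColimitCofanMapLeftAdjoint {C : Type u₁} [Category.{v₁} C] {D : Type u₂}
    [Category.{v₂} D] {F : C ⥤ D} {G : D ⥤ C} (adj : F ⊣ G) {I : Type*} {T : C}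
    {s : Cofan (fun _ : I => T)} (hs : IsColimit s) {S : D} (e : S ≅ F.obj T) :
    IsColimit (Cofan.mk (f := fun _ : I => S) (F.obj s.pt) fun i => e.hom ≫ F.map (s.inj i)) :=
  Cofan.IsColimit.mk _
    (fun t => (adj.homEquiv _ _).symm
      (Cofan.IsColimit.desc hs fun i => adj.homEquiv _ _ (e.inv ≫ t.inj i)))
    (fun t i => by
      change (e.hom ≫ F.map (s.inj i)) ≫ _ = _
      rw [Category.assoc, ← adj.homEquiv_naturality_left_symm,
        Cofan.IsColimit.fac, Equiv.symm_apply_apply, e.hom_inv_id_assoc])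
    (fun t m hm => by
      rw [Equiv.eq_symm_apply]
      refine Cofan.IsColimit.hom_ext hs _ _ fun i => ?_
      rw [Cofan.IsColimit.fac, ← adj.homEquiv_naturality_left, ← hm i]
      change _ = adj.homEquiv _ _ (e.inv ≫ (e.hom ≫ F.map (s.inj i)) ≫ m)
      rw [Category.assoc, e.inv_hom_id_assoc])

/-! ### Transport of Hom-exactness along adjunctions. -/

section Adjunction

variable {C : Type u₁} [Category.{v₁} C] [Abelian C] {D : Type u₂} [Category.{v₂} D] [Abelian D]
  {F : C ⥤ D} {G : D ⥤ C} [F.Additive] [G.Additive] {ι : Type*} {c : ComplexShape ι}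

lemma HomFromExactAt.map_right_adjoint (adj : F ⊣ G) {M : C} {K : HomologicalComplex D c} {j : ι}
    (h : HomFromExactAt (F.obj M) K j) :
    HomFromExactAt M ((G.mapHomologicalComplex c).obj K) j := by
  intro (f : M ⟶ G.obj (K.X j)) hf
  replace hf : f ≫ G.map (K.d j (c.next j)) = 0 := hf
  obtain ⟨g, hg⟩ := h ((adj.homEquiv _ _).symm f) (by
    rw [← adj.homEquiv_naturality_right_symm, hf, adj.homEquiv_counit, F.map_zero, zero_comp])
  refine ⟨adj.homEquiv _ _ g, ?_⟩
  change adj.homEquiv _ _ g ≫ G.map _ = f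
  rw [← adj.homEquiv_naturality_right, hg, Equiv.apply_symm_apply]

lemma HomToExactAt.map_left_adjoint (adj : F ⊣ G) {K : HomologicalComplex C c} {N : D} {j : ι}
    (h : HomToExactAt K (G.obj N) j) :
    HomToExactAt ((F.mapHomologicalComplex c).obj K) N j := by
  intro (f : F.obj (K.X j) ⟶ N) hf
  replace hf : F.map (K.d (c.prev j) j) ≫ f = 0 := hf
  obtain ⟨g, hg⟩ := h (adj.homEquiv _ _ f) (by
    rw [← adj.homEquiv_naturality_left, hf, adj.homEquiv_unit, G.map_zero, comp_zero])
  refine ⟨(adj.homEquiv _ _).symm g, ?_⟩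
  change F.map _ ≫ (adj.homEquiv _ _).symm g = f
  rw [← adj.homEquiv_naturality_left_symm, hg, Equiv.symm_apply_apply]

end Adjunction

/-! ### Consequences of the recollement axioms and of exactness of `i^*`. -/

namespace Recollement

variable {A' : Type u₁} [Category.{v₁} A'] [Abelian A']
  {A : Type u₂} [Category.{v₂} A] [Abelian A]
  {A'' : Type u₃} [Category.{v₃} A''] [Abelian A''] (R : Recollement A' A A'')

instance : R.iUpperStar.Additive := R.iUpperStar_additive
instance : R.iLowerStar.Additive := R.iLowerStar_additive
instance : R.iUpperShriek.Additive := R.iUpperShriek_additive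
instance : R.jLowerShriek.Additive := R.jLowerShriek_additive
instance : R.jUpperStar.Additive := R.jUpperStar_additive
instance : R.jLowerStar.Additive := R.jLowerStar_additive
instance : R.iLowerStar.Full := R.iLowerStar_full
instance : R.iLowerStar.Faithful := R.iLowerStar_faithful
instance : R.jLowerShriek.Full := R.jLowerShriek_full
instance : R.jLowerShriek.Faithful := R.jLowerShriek_faithful

lemma isZero_jUpperStar_iLowerStar (M : A') : IsZero (R.jUpperStar.obj (R.iLowerStar.obj M)) :=
  (R.essImage_iff _).1 (R.iLowerStar.obj_mem_essImage M)

/-- By the two adjunctions, `Hom(i^* j_! M, Z) = Hom(M, j^* i_* Z) = 0`. -/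
lemma isZero_iUpperStar_jLowerShriek (M : A'') :
    IsZero (R.iUpperStar.obj (R.jLowerShriek.obj M)) := by
  rw [IsZero.iff_id_eq_zero]
  apply (R.iAdj₁.homEquiv _ _).injective
  apply (R.jAdj₁.homEquiv _ _).injective
  exact (R.isZero_jUpperStar_iLowerStar _).eq_of_tgt _ _

variable {R} in
-- If `j^* M = 0` then `M ≅ i_* N`, and `N ≅ i^* i_* N ≅ i^* M` vanishes.
lemma isZero_of_isZero {M : A} (h₁ : IsZero (R.iUpperStar.obj M))
    (h₂ : IsZero (R.jUpperStar.obj M)) : IsZero M := by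
  obtain ⟨N, ⟨e⟩⟩ := (R.essImage_iff M).2 h₂
  have hN : IsZero N := (h₁.of_iso (R.iUpperStar.mapIso e)).of_iso
    (asIso (R.iAdj₁.counit.app N)).symm
  exact (R.iLowerStar.map_isZero hN).of_iso e.symm

instance : PreservesFiniteLimits R.jUpperStar :=
  have := R.jAdj₁.rightAdjoint_preservesLimits
  inferInstance

instance : PreservesFiniteColimits R.jUpperStar :=
  have := R.jAdj₂.leftAdjoint_preservesColimits
  inferInstance

/-- The kernel of `j_! f` is killed by `i^*`, as a subobject of `i^* j_! M = 0`, and by `j^*`, since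
`j^* j_! f` is conjugate to the mono `f`. -/
lemma jLowerShriek_preservesMonomorphisms [PreservesFiniteLimits R.iUpperStar] :
    R.jLowerShriek.PreservesMonomorphisms where
  preserves {M N} f _ := by
    have key {Z : A} (k : Z ⟶ R.jLowerShriek.obj M) [Mono k]
        (hk : k ≫ R.jLowerShriek.map f = 0) : IsZero Z := by
      apply isZero_of_isZero (R := R)
      · exact (R.isZero_iUpperStar_jLowerShriek M).of_mono (R.iUpperStar.map k)
      · have hm : R.jUpperStar.map (R.jLowerShriek.map f) =
            inv (R.jAdj₁.unit.app M) ≫ f ≫ R.jAdj₁.unit.app N := by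
          rw [IsIso.eq_inv_comp]
          exact (R.jAdj₁.unit.naturality f).symm
        have : Mono (R.jUpperStar.map (R.jLowerShriek.map f)) := by
          rw [hm]; infer_instance
        have h0 : R.jUpperStar.map k = 0 := by
          rw [← cancel_mono (R.jUpperStar.map (R.jLowerShriek.map f)), ← Functor.map_comp, hk,
            Functor.map_zero, zero_comp]
        exact IsZero.of_mono_eq_zero _ h0
    refine Preadditive.mono_of_kernel_zero ?_
    exact (key (kernel.ι (R.jLowerShriek.map f)) (kernel.condition _)).eq_of_src _ _

lemma jLowerShriek_preservesHomology [PreservesFiniteLimits R.iUpperStar] :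
    R.jLowerShriek.PreservesHomology := by
  have := R.jLowerShriek_preservesMonomorphisms
  have := R.jAdj₁.leftAdjoint_preservesColimits
  exact Functor.preservesHomology_of_preservesMonos_and_cokernels _

/-- When `i^*` is exact, `i^*` detects vanishing of morphisms from the image of `i_*`. -/
lemma eq_zero_of_iUpperStar_map_eq_zero [PreservesFiniteLimits R.iUpperStar] {M : A'} {N : A}
    (f : R.iLowerStar.obj M ⟶ N) (hf : R.iUpperStar.map f = 0) : f = 0 := by
  have := R.iAdj₁.leftAdjoint_preservesColimits
  -- Exactness of `i^*` gives `i^*(im f) = im(i^* f) = 0`, while `j^*(im f)` is a quotient of `j^*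
  -- i_* M = 0`.
  have hz : IsZero (Abelian.image f) := by
    apply isZero_of_isZero (R := R)
    · have h0 : R.iUpperStar.map (Abelian.image.ι f) = 0 := by
        rw [← cancel_epi (R.iUpperStar.map (Abelian.factorThruImage f)), ← Functor.map_comp,
          Abelian.image.fac, hf, comp_zero]
      exact IsZero.of_mono_eq_zero _ h0
    · exact (R.isZero_jUpperStar_iLowerStar M).of_epi
        (R.jUpperStar.map (Abelian.factorThruImage f))
  rw [← Abelian.image.fac f, hz.eq_of_src (Abelian.image.ι f) 0, comp_zero]

/-! ### Coproducts of copies of `i_* T' ⊞ j_! T''`. -/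

section Sum

variable (T' : A') (T'' : A'')

/-- `T' ≅ i^*(i_* T' ⊞ j_! T'')`. -/
noncomputable def iUpperStarSumIso :
    T' ≅ R.iUpperStar.obj (R.iLowerStar.obj T' ⊞ R.jLowerShriek.obj T'') where
  hom := inv (R.iAdj₁.counit.app T') ≫ R.iUpperStar.map biprod.inl
  inv := R.iUpperStar.map biprod.fst ≫ R.iAdj₁.counit.app T'
  hom_inv_id := by
    rw [Category.assoc, ← Functor.map_comp_assoc, biprod.inl_fst, CategoryTheory.Functor.map_id,
      Category.id_comp, IsIso.inv_hom_id]
  inv_hom_id := by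
    rw [Category.assoc, IsIso.hom_inv_id_assoc, ← Functor.map_comp]
    -- The complementary idempotent factors through `j_! T''`, which `i^*` kills.
    have h : (biprod.snd : R.iLowerStar.obj T' ⊞ R.jLowerShriek.obj T'' ⟶ _) ≫ biprod.inr =
        𝟙 _ - biprod.fst ≫ biprod.inl := by
      rw [eq_sub_iff_add_eq, add_comm, biprod.total]
    have h0 : R.iUpperStar.map (𝟙 (R.iLowerStar.obj T' ⊞ R.jLowerShriek.obj T'') -
        biprod.fst ≫ biprod.inl) = 0 := by
      rw [← h, Functor.map_comp,
        (R.isZero_iUpperStar_jLowerShriek T'').eq_zero_of_tgt (R.iUpperStar.map biprod.snd),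
        zero_comp]
    rw [Functor.map_sub, CategoryTheory.Functor.map_id, sub_eq_zero] at h0
    exact h0.symm

/-- `T'' ≅ j^*(i_* T' ⊞ j_! T'')`. -/
noncomputable def jUpperStarSumIso :
    T'' ≅ R.jUpperStar.obj (R.iLowerStar.obj T' ⊞ R.jLowerShriek.obj T'') where
  hom := R.jAdj₁.unit.app T'' ≫ R.jUpperStar.map biprod.inr
  inv := R.jUpperStar.map biprod.snd ≫ inv (R.jAdj₁.unit.app T'')
  hom_inv_id := by
    rw [Category.assoc, ← Functor.map_comp_assoc, biprod.inr_snd, CategoryTheory.Functor.map_id,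
      Category.id_comp, IsIso.hom_inv_id]
  inv_hom_id := by
    rw [Category.assoc, IsIso.inv_hom_id_assoc, ← Functor.map_comp]
    have h : (biprod.fst : R.iLowerStar.obj T' ⊞ R.jLowerShriek.obj T'' ⟶ _) ≫ biprod.inl =
        𝟙 _ - biprod.snd ≫ biprod.inr := by
      rw [eq_sub_iff_add_eq, biprod.total]
    have h0 : R.jUpperStar.map (𝟙 (R.iLowerStar.obj T' ⊞ R.jLowerShriek.obj T'') -
        biprod.snd ≫ biprod.inr) = 0 := by
      rw [← h, Functor.map_comp,
        (R.isZero_jUpperStar_iLowerStar T').eq_zero_of_tgt (R.jUpperStar.map biprod.fst),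
        zero_comp]
    rw [Functor.map_sub, CategoryTheory.Functor.map_id, sub_eq_zero] at h0
    exact h0.symm

variable {T' T''} {I : Type w}
  {c : Cofan (fun _ : I => R.iLowerStar.obj T' ⊞ R.jLowerShriek.obj T'')}

/-- The unit `N ⟶ i_* i^* N` is a split epimorphism when `N` is a coproduct of copies of
`i_* T' ⊞ j_! T''`. -/
lemma exists_section_unit (hc : IsColimit c) :
    ∃ s : R.iLowerStar.obj (R.iUpperStar.obj c.pt) ⟶ c.pt,
      s ≫ R.iAdj₁.unit.app c.pt = 𝟙 _ := by
  have hc₁ := isColimitCofanMapLeftAdjoint R.iAdj₁ hc (R.iUpperStarSumIso T' T'')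
  -- Since `i_*` is also a left adjoint, `i_* i^* N` is a coproduct of copies of `i_* T'`; the
  -- section is induced by the inclusions of `i_* T'` in the summands.
  have hc₂ := isColimitCofanMapLeftAdjoint R.iAdj₂ hc₁ (Iso.refl (R.iLowerStar.obj T'))
  refine ⟨Cofan.IsColimit.desc hc₂ fun i => biprod.inl ≫ c.inj i, ?_⟩
  refine Cofan.IsColimit.hom_ext hc₂ _ _ fun i => ?_
  rw [Cofan.IsColimit.fac_assoc]
  have h₁ : c.inj i ≫ R.iAdj₁.unit.app c.pt = R.iAdj₁.unit.app _ ≫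
      R.iLowerStar.map (R.iUpperStar.map (c.inj i)) := R.iAdj₁.unit.naturality (c.inj i)
  have h₂ : (biprod.inl : _ ⟶ R.iLowerStar.obj T' ⊞ R.jLowerShriek.obj T'') ≫
      R.iAdj₁.unit.app _ = R.iAdj₁.unit.app _ ≫ R.iLowerStar.map (R.iUpperStar.map biprod.inl) :=
    R.iAdj₁.unit.naturality _
  have h₃ : R.iLowerStar.map (inv (R.iAdj₁.counit.app T')) =
      R.iAdj₁.unit.app (R.iLowerStar.obj T') := by
    rw [Functor.map_inv, IsIso.inv_eq_of_hom_inv_id]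
    rw [← cancel_epi (R.iAdj₁.unit.app (R.iLowerStar.obj T'))]
    simp
  rw [Category.assoc, h₁, reassoc_of% h₂, ← h₃]
  simp [iUpperStarSumIso]

/-- Every map `i_* M ⟶ N` factors through the split unit `N ⟶ i_* i^* N`, and full faithfulness of
`i_*` moves the problem to `A'`. -/
lemma homToExactAt_iLowerStar [PreservesFiniteLimits R.iUpperStar] (hc : IsColimit c)
    {ι : Type*} {σ : ComplexShape ι} {K : HomologicalComplex A' σ} {j : ι}
    (hK : HomToExactAt K (R.iUpperStar.obj c.pt) j) :
    HomToExactAt ((R.iLowerStar.mapHomologicalComplex σ).obj K) c.pt j := by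
  intro (f : R.iLowerStar.obj (K.X j) ⟶ c.pt) hf
  replace hf : R.iLowerStar.map (K.d (σ.prev j) j) ≫ f = 0 := hf
  obtain ⟨s, hs⟩ := R.exists_section_unit hc
  -- The two sides agree after composing with the unit, so by naturality `i^*` identifies them.
  have hfs : f = f ≫ R.iAdj₁.unit.app c.pt ≫ s := by
    rw [← sub_eq_zero]
    apply R.eq_zero_of_iUpperStar_map_eq_zero
    apply R.iLowerStar.map_injective
    rw [← cancel_epi (R.iAdj₁.unit.app (R.iLowerStar.obj (K.X j)))]
    have := R.iAdj₁.unit.naturality (f - f ≫ R.iAdj₁.unit.app c.pt ≫ s)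
    dsimp only [Functor.comp_map, Functor.id_map] at this
    rw [← this, Functor.map_zero, comp_zero]
    simp [hs]
  obtain ⟨θ, hθ⟩ := R.iLowerStar.map_surjective (f ≫ R.iAdj₁.unit.app c.pt)
  obtain ⟨ψ, hψ⟩ := hK θ (by
    apply R.iLowerStar.map_injective
    rw [Functor.map_comp, hθ, reassoc_of% hf, zero_comp, Functor.map_zero])
  refine ⟨R.iLowerStar.map ψ ≫ s, ?_⟩
  change R.iLowerStar.map (K.d j (σ.next j)) ≫ R.iLowerStar.map ψ ≫ s = f
  rw [← Functor.map_comp_assoc, hψ, hθ, Category.assoc, ← hfs]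

end Sum

/-! ### The glued resolution. -/

section Glue

variable {X' Y' : ObjectProperty A'} {X'' Y'' : ObjectProperty A''}

lemma glueLeft_iLowerStar (hX' : IsAdditiveSubcategory X') (hX'' : IsAdditiveSubcategory X'')
    {M : A'} (hM : X' M) : R.glueLeft X' X'' (R.iLowerStar.obj M) :=
  ⟨hX'.of_iso (asIso (R.iAdj₁.counit.app M)).symm hM,
    hX''.zero (R.isZero_jUpperStar_iLowerStar M)⟩

lemma glueLeft_jLowerShriek (hX' : IsAdditiveSubcategory X') (hX'' : IsAdditiveSubcategory X'')
    {M : A''} (hM : X'' M) : R.glueLeft X' X'' (R.jLowerShriek.obj M) :=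
  ⟨hX'.zero (R.isZero_iUpperStar_jLowerShriek M),
    hX''.of_iso (asIso (R.jAdj₁.unit.app M)) hM⟩

lemma homFromAcyclic_iLowerStar {ι : Type*} {σ : ComplexShape ι} {K : HomologicalComplex A' σ}
    (hK : HomFromAcyclic X' K) :
    HomFromAcyclic (R.glueLeft X' X'') ((R.iLowerStar.mapHomologicalComplex σ).obj K) := by
  rw [homFromAcyclic_iff] at *
  exact fun D hD j => (hK _ hD.1 j).map_right_adjoint R.iAdj₁

/-- With `j_!` exact, the adjunction `(j_!, j^*)` yields acyclicity against `Y`; the balanced pair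
converts it to acyclicity against `X`. -/
lemma homFromAcyclic_jLowerShriek [PreservesFiniteLimits R.iUpperStar]
    (h : IsAdmissibleBalancedPair (R.glueLeft X' X'') (R.glueRight Y' Y''))
    {K : ChainComplex A'' ℕ} (hK : K.Acyclic) (hK' : HomToAcyclic Y'' K) :
    HomFromAcyclic (R.glueLeft X' X'') ((R.jLowerShriek.mapHomologicalComplex _).obj K) := by
  have := R.jLowerShriek_preservesHomology
  apply h.homFromAcyclic_of_homToAcyclic
  · exact fun j => ShortComplex.Exact.map (hK j) R.jLowerShriek
  · rw [homToAcyclic_iff] at *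
    exact fun D hD j => (hK' _ hD.2 j).map_left_adjoint R.jAdj₁

/-- The augmented resolution of `i_* T' ⊞ j_! T''` induced by resolutions of `T'` and `T''`. -/
noncomputable def sumAugmented {T' : A'} {T'' : A''} (P' : LeftResolution X' T')
    (P'' : LeftResolution X'' T'') : ChainComplex A ℕ :=
  biprodComplex ((R.iLowerStar.mapHomologicalComplex _).obj P'.augmented)
    ((R.jLowerShriek.mapHomologicalComplex _).obj P''.augmented)

variable {T' : A'} {T'' : A''} (P' : LeftResolution X' T') (P'' : LeftResolution X'' T'')

lemma glueLeft_sumAugmented (h' : IsAdmissibleBalancedPair X' Y')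
    (h'' : IsAdmissibleBalancedPair X'' Y'')
    (h : IsAdmissibleBalancedPair (R.glueLeft X' X'') (R.glueRight Y' Y'')) (i : ℕ) :
    R.glueLeft X' X'' ((R.sumAugmented P' P'').X (i + 1)) :=
  h.additive_left.biprod
    (R.glueLeft_iLowerStar h'.additive_left h''.additive_left (P'.mem i))
    (R.glueLeft_jLowerShriek h'.additive_left h''.additive_left (P''.mem i))

lemma homFromAcyclic_sumAugmented [PreservesFiniteLimits R.iUpperStar]
    (h'' : IsAdmissibleBalancedPair X'' Y'')
    (h : IsAdmissibleBalancedPair (R.glueLeft X' X'') (R.glueRight Y' Y'')) :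
    HomFromAcyclic (R.glueLeft X' X'') (R.sumAugmented P' P'') :=
  (R.homFromAcyclic_iLowerStar P'.acyclic).biprod
    (R.homFromAcyclic_jLowerShriek h (h''.acyclic P''.acyclic) (h''.homToAcyclic P''))

end Glue

end Recollement

end RelTilt

theorem proposition4p2
    {A' : Type u₁} [Category.{v₁} A'] [Abelian A']
    {A : Type u₂} [Category.{v₂} A] [Abelian A]
    {A'' : Type u₃} [Category.{v₃} A''] [Abelian A'']
    (R : RelTilt.Recollement A' A A'')
    {X' Y' : ObjectProperty A'} {X'' Y'' : ObjectProperty A''}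
    (h' : RelTilt.IsAdmissibleBalancedPair X' Y')
    (h'' : RelTilt.IsAdmissibleBalancedPair X'' Y'')
    (h : RelTilt.IsAdmissibleBalancedPair (R.glueLeft X' X'') (R.glueRight Y' Y''))
    (hi : exactFunctor A A' R.iUpperStar)
    (n : ℕ) (T' : A') (T'' : A'')
    (hT' : RelTilt.IsPartialTilting.{w} h' n T')
    (hT'' : RelTilt.IsPartialTilting.{w} h'' n T'') :
    RelTilt.IsPartialTilting.{w} h n (R.iLowerStar.obj T' ⊞ R.jLowerShriek.obj T'') := by
  have : PreservesFiniteLimits R.iUpperStar := ((exactFunctor_iff _).1 hi).1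
  refine ⟨?_, fun I c hc i hpos => ?_⟩
  · obtain ⟨P', hP', -⟩ := RelTilt.exists_of_leftDim_le hT'.leftDim_le
    obtain ⟨P'', hP'', -⟩ := RelTilt.exists_of_leftDim_le hT''.leftDim_le
    exact RelTilt.leftDim_le_of_augmented h (R.sumAugmented P' P'')
      (R.glueLeft_sumAugmented P' P'' h' h'' h) (R.homFromAcyclic_sumAugmented P' P'' h'' h)
      fun i hi => (biprod_isZero_iff _ _).2
        ⟨R.iLowerStar.map_isZero (hP' i hi), R.jLowerShriek.map_isZero (hP'' i hi)⟩
  -- Self-orthogonality applies to `i^*` and `j^*` of the given coproduct, which are themselves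
  -- coproducts of copies of `T'` and `T''`.
  · have e' := hT'.selfOrthogonal I _
      (RelTilt.isColimitCofanMapLeftAdjoint R.iAdj₁ hc (R.iUpperStarSumIso T' T'')) i hpos
    have e'' := hT''.selfOrthogonal I _
      (RelTilt.isColimitCofanMapLeftAdjoint R.jAdj₂ hc (R.jUpperStarSumIso T' T'')) i hpos
    rw [RelTilt.isZero_relExt_iff _ hpos] at e' e''
    exact RelTilt.isZero_relExt_of_augmented _ hpos
      (R.sumAugmented (h'.resolution T') (h''.resolution T''))
      (R.glueLeft_sumAugmented _ _ h' h'' h) (R.homFromAcyclic_sumAugmented _ _ h'' h)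
      (Iso.refl _)
      ((R.homToExactAt_iLowerStar hc e').biprod (e''.map_left_adjoint R.jAdj₁))
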